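/- Let $f\colon\mathbb{R}^d\to\mathbb{R}$ be locally Lipschitz, where $\mathbb{R}^d$ carries the Euclidean inner product and norm. Its Clarke subdifferential at $x$ is $$\partial f(x)=\mathrm{conv}\Big\{\lim_{i\to\infty}\nabla f(u_i) : u_i\to x,\ f \text{ differentiable at each } u_i\Big\}$$ (the set of all such limits that exist). A point $x$ is called critical for $f$ if $0\in\partial f(x)$, and $r\in\mathbb{R}$ is a critical value if $r=f(x)$ for some critical point $x$; every other real number is a noncritical value. An arc is a curve $z\colon[0,\infty)\to\mathbb{R}^d$ of the form $z(t)=z(0)+\int_0^t v(\tau)\,d\tau$ with $v$ integrable on compact intervals. Let $\{x_k\},\{y_k\},\{\xi_k\}$, $k=0,1,2,\dots$, be sequences of random vectors in $\mathbb{R}^d$ on a probability space and let $\{\alpha_k\}$ be a deterministic sequence of real numbers such that, almost surely, for all $k$, $$x_{k+1}=x_k-\alpha_k(y_k+\xi_k),\qquad y_k\in\partial f(x_k).$$ Suppose that the following hold. 1. $\alpha_k\ge 0$ for all $k$, $\sum_k\alpha_k=\infty$ and $\sum_k\alpha_k^2<\infty$. 2. Almost surely, $\sup_k\|x_k\|<\infty$.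 3. $\{\xi_k\}$ is a martingale difference sequence with controlled conditional second moments: let $\mathcal{F}_k$ be the $\sigma$-field generated by $x_j,y_j$ for $j\le k$ and by $\xi_j$ for $j<k$; each $\xi_k$ is integrable, and there is a function $p\colon\mathbb{R}^d\to[0,\infty)$, bounded on bounded sets, such that almost surely, for all $k$, $$\mathbb{E}[\xi_k\mid\mathcal{F}_k]=0\qquad\text{and}\qquad \mathbb{E}[\|\xi_k\|^2\mid\mathcal{F}_k]\le p(x_k).$$ 4. (Weak Sard) The set of noncritical values of $f$ is dense in $\mathbb{R}$. 5. (Descent) Whenever $z\colon[0,\infty)\to\mathbb{R}^d$ is an arc with $\dot z(t)\in-\partial f(z(t))$ for almost every $t\ge 0$ and $z(0)$ is not critical for $f$, there is a real $T>0$ with $$f(z(T))<\sup_{t\in[0,T]}f(z(t))\le f(z(0)).$$ Then, almost surely, every limit point of $\{x_k\}$ is critical for $f$ and the sequence $\{f(x_k)\}$ converges. -/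

import Mathlib

open MeasureTheory Filter Topology Set
open scoped ENNReal

noncomputable section

/-- The Clarke subdifferential of `f` at `x`: the convex hull of all limits of gradients `∇f(uᵢ)`
along sequences `uᵢ → x` of points at which `f` is differentiable. -/
def clarkeSubdifferential {d : ℕ} (f : EuclideanSpace ℝ (Fin d) → ℝ)
    (x : EuclideanSpace ℝ (Fin d)) : Set (EuclideanSpace ℝ (Fin d)) :=
  convexHull ℝ {v | ∃ u : ℕ → EuclideanSpace ℝ (Fin d),
    (∀ i, DifferentiableAt ℝ f (u i)) ∧ Tendsto u atTop (𝓝 x) ∧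
      Tendsto (fun i => gradient f (u i)) atTop (𝓝 v)}

/-- `x` is Clarke critical for `f`. -/
def IsClarkeCritical {d : ℕ} (f : EuclideanSpace ℝ (Fin d) → ℝ)
    (x : EuclideanSpace ℝ (Fin d)) : Prop :=
  0 ∈ clarkeSubdifferential f x

/-- The critical values of `f`. -/
def criticalValues {d : ℕ} (f : EuclideanSpace ℝ (Fin d) → ℝ) : Set ℝ :=
  {r | ∃ x, IsClarkeCritical f x ∧ f x = r}

/-- `z`, considered on `[0, ∞)` only, is an arc (an absolutely continuous curve): it is the
indefinite integral of a function that is integrable on compact intervals. -/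
def IsArc {d : ℕ} (z : ℝ → EuclideanSpace ℝ (Fin d)) : Prop :=
  ∃ y : ℝ → EuclideanSpace ℝ (Fin d),
    (∀ T : ℝ, 0 ≤ T → IntervalIntegrable y volume 0 T) ∧
      ∀ t : ℝ, 0 ≤ t → z t = z 0 + ∫ τ in (0 : ℝ)..t, y τ

/-- `z`, considered on `[0, ∞)` only, is a trajectory of the differential inclusion
`z'(t) ∈ -∂f(z(t))` for a.e. `t ≥ 0`. -/
def IsSubgradientTrajectory {d : ℕ} (f : EuclideanSpace ℝ (Fin d) → ℝ)
    (z : ℝ → EuclideanSpace ℝ (Fin d)) : Prop :=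
  IsArc z ∧ ∀ᵐ t : ℝ, 0 ≤ t →
    DifferentiableAt ℝ z t ∧ -deriv z t ∈ clarkeSubdifferential f (z t)

/-- Weak Sard: the set of noncritical values of `f` is dense in `ℝ`. -/
def WeakSard {d : ℕ} (f : EuclideanSpace ℝ (Fin d) → ℝ) : Prop :=
  Dense (criticalValues f)ᶜ

/-- Descent: along each subgradient trajectory `z` that starts at a noncritical point there is
`T > 0` with `f(z(T)) < sup_{t ∈ [0,T]} f(z(t)) ≤ f(z(0))`. -/
def DescentCondition {d : ℕ} (f : EuclideanSpace ℝ (Fin d) → ℝ) : Prop :=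
  ∀ z : ℝ → EuclideanSpace ℝ (Fin d), IsSubgradientTrajectory f z →
    ¬ IsClarkeCritical f (z 0) →
      ∃ T : ℝ, 0 < T ∧
        f (z T) < sSup ((fun t => f (z t)) '' Icc 0 T) ∧
        sSup ((fun t => f (z t)) '' Icc 0 T) ≤ f (z 0)

/-- The σ-field of the information available when the noise `ξₖ` is drawn, generated by `xⱼ`, `yⱼ`
for `j ≤ k` and by `ξⱼ` for `j < k`. -/
@[reducible] def pastSigmaField {Ω : Type*} {d : ℕ} (x y ξ : ℕ → Ω → EuclideanSpace ℝ (Fin d)) (k : ℕ) :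
    MeasurableSpace Ω :=
  (⨆ j : ℕ, ⨆ _ : j ≤ k,
      (MeasurableSpace.comap (x j) inferInstance ⊔ MeasurableSpace.comap (y j) inferInstance)) ⊔
    ⨆ j : ℕ, ⨆ _ : j < k, MeasurableSpace.comap (ξ j) inferInstance

/-- `ξ` is a martingale difference sequence with respect to the σ-fields `pastSigmaField x y ξ`,
with conditional second moments `𝔼[‖ξₖ‖² | ℱₖ] ≤ p(xₖ)` for some `p ≥ 0` that is bounded on bounded
sets. The conditional second moment is that of a `[0, ∞]`-valued function, so `‖ξₖ‖²` need not have
a finite expectation. -/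
def IsControlledNoise {Ω : Type*} [MeasurableSpace Ω] {d : ℕ} (P : Measure Ω)
    (x y ξ : ℕ → Ω → EuclideanSpace ℝ (Fin d)) : Prop :=
  (∀ k, Integrable (ξ k) P) ∧
  (∀ᵐ ω ∂P, ∀ k, (condExp (pastSigmaField x y ξ k) P (ξ k)) ω = 0) ∧
  ∃ p : EuclideanSpace ℝ (Fin d) → ℝ, (∀ a, 0 ≤ p a) ∧
    (∀ s, Bornology.IsBounded s → BddAbove (p '' s)) ∧
    ∀ᵐ ω ∂P, ∀ k,
      condLExp (pastSigmaField x y ξ k) P (fun ω' => ENNReal.ofReal (‖ξ k ω'‖ ^ 2)) ω ≤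
        ENNReal.ofReal (p (x k ω))

end

/-! The noise is negligible in the long run. Cut off on the event `‖x k‖ ≤ R`, which is decided
before `ξ k` is drawn, the terms `α k • ξ k` are martingale differences with summable variances, so
on bounded paths their series converges almost surely (`IsControlledNoise.ae_tendsto_sum`). The rest
is deterministic. Placing `x n` at time `t n = ∑ k < n, α k` and correcting by the tail of the noise
series gives a Lipschitz curve `V`, asymptotic to the iterates, whose velocity is minus a
subgradient at a point ever closer to it. Upper semicontinuity and convexity of the Clarke
subdifferential turn limits of the shifts `V (τ i + ·)` into subgradient trajectories
(`LocallyLipschitz.exists_subgradientTrajectory_tendsto`).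

Descent acts through these limits (`LocallyLipschitz.critical_of_mapClusterPt_and_tendsto`). If `f
(x k)` did not converge, weak Sard would provide noncritical levels `a < b` crossed upward
infinitely often. Shifts begun at the crossings of `a` converge to a trajectory `z` from level `a`,
which stays at or below `a` on `[0, T]` and ends strictly below it. Hence level `b` is not reached
within time `T`, the iterates are still above `a` at time `T`, and `f (z T) ≥ a`, a contradiction.
Once `f (x k)` converges, `f` is constant along every limit trajectory, so none can start at a
noncritical point. -/

/-! ### Compactness of convex hulls -/

theorem sum_eq_sum_comp_embedding {ι κ F : Type*} [Fintype ι] [Fintype κ] [AddCommMonoid F]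
    (e : ι ↪ κ) {g : κ → F} (hg : ∀ i ∉ range e, g i = 0) : ∑ i, g i = ∑ j, g (e j) := by
  rw [← Finset.sum_map Finset.univ e g]
  refine (Finset.sum_subset (Finset.subset_univ _) fun i _ hi => hg i ?_).symm
  simpa using hi

/-- In a finite-dimensional space the convex hull of a compact set is compact. -/
theorem IsCompact.convexHull_of_finiteDimensional {E : Type*} [NormedAddCommGroup E]
    [NormedSpace ℝ E] [FiniteDimensional ℝ E] {s : Set E} (hs : IsCompact s) :
    IsCompact (convexHull ℝ s) := by
  classical
  rcases s.eq_empty_or_nonempty with rfl | ⟨a, ha⟩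
  · simp
  -- Carathéodory: `n` points suffice, so the hull is the continuous image of the compact set
  -- simplex times `s ^ n`.
  let n := Module.finrank ℝ E + 1
  let Φ : (Fin n → ℝ) × (Fin n → E) → E := fun p => ∑ i, p.1 i • p.2 i
  have hΦ : Continuous Φ := by fun_prop
  have hK : IsCompact (stdSimplex ℝ (Fin n) ×ˢ Set.pi univ fun _ : Fin n => s) :=
    (isCompact_stdSimplex ℝ (Fin n)).prod (isCompact_univ_pi fun _ => hs)
  convert hK.image hΦ
  apply Subset.antisymm
  · intro v hv
    obtain ⟨ι, _, z, w, hz, hind, hw, hw1, rfl⟩ := eq_pos_convex_span_of_mem_convexHull hv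
    have hcard : Fintype.card ι ≤ n :=
      hind.card_le_finrank_succ.trans (Nat.succ_le_succ (Submodule.finrank_le _))
    obtain ⟨e⟩ : Nonempty (ι ↪ Fin n) :=
      Function.Embedding.nonempty_of_card_le (by simpa using hcard)
    -- Missing vertices are filled in by the point `a` with weight `0`.
    let W : Fin n → ℝ := Function.extend e w 0
    let Z : Fin n → E := Function.extend e z fun _ => a
    have hWe (j) : W (e j) = w j := e.injective.extend_apply _ _ _
    have hZe (j) : Z (e j) = z j := e.injective.extend_apply _ _ _
    have hW0 (i) (hi : i ∉ range e) : W i = 0 := Function.extend_apply' _ _ _ hi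
    have hZ0 (i) (hi : i ∉ range e) : Z i = a := Function.extend_apply' _ _ _ hi
    refine ⟨(W, Z), ⟨⟨fun i => ?_, ?_⟩, fun i _ => ?_⟩, ?_⟩
    · by_cases hi : i ∈ range e
      · obtain ⟨j, rfl⟩ := hi
        exact (hw j).le.trans_eq (hWe j).symm
      · exact (hW0 i hi).ge
    · change ∑ i, W i = 1
      rw [sum_eq_sum_comp_embedding e hW0, ← hw1]
      exact Finset.sum_congr rfl fun j _ => hWe j
    · by_cases hi : i ∈ range e
      · obtain ⟨j, rfl⟩ := hi
        change Z (e j) ∈ s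
        exact (hZe j).symm ▸ hz (mem_range_self j)
      · change Z i ∈ s
        exact (hZ0 i hi).symm ▸ ha
    · change ∑ i, W i • Z i = _
      rw [sum_eq_sum_comp_embedding e (g := fun i => W i • Z i)
        fun i hi => by rw [hW0 i hi, zero_smul]]
      exact Finset.sum_congr rfl fun j _ => by rw [hWe, hZe]
  · rintro _ ⟨⟨w, z⟩, ⟨hw, hz⟩, rfl⟩
    exact (convex_convexHull ℝ s).sum_mem (fun i _ => hw.1 i) hw.2
      fun i _ => subset_convexHull ℝ s (hz i (mem_univ i))

/-! ### Boundedness, compactness and upper semicontinuity of the Clarke subdifferential -/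

section Clarke

variable {d : ℕ} {f : EuclideanSpace ℝ (Fin d) → ℝ}

/-- The limits of gradients of `f` along sequences of differentiability points tending to `x`. -/
def limitingGradients (f : EuclideanSpace ℝ (Fin d) → ℝ) (x : EuclideanSpace ℝ (Fin d)) :
    Set (EuclideanSpace ℝ (Fin d)) :=
  {v | ∃ u : ℕ → EuclideanSpace ℝ (Fin d),
    (∀ i, DifferentiableAt ℝ f (u i)) ∧ Tendsto u atTop (𝓝 x) ∧
      Tendsto (fun i => gradient f (u i)) atTop (𝓝 v)}

/-- Exhibits the limiting gradients at `x` as a slice of the closed graph of the gradient, which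
replaces a diagonal argument for closedness. -/
theorem mem_limitingGradients_iff {x v : EuclideanSpace ℝ (Fin d)} :
    v ∈ limitingGradients f x ↔
      (x, v) ∈ closure ((fun u => (u, gradient f u)) '' {u | DifferentiableAt ℝ f u}) := by
  rw [mem_closure_iff_seq_limit]
  constructor
  · rintro ⟨u, hu, hux, huv⟩
    exact ⟨fun i => (u i, gradient f (u i)), fun i => ⟨u i, hu i, rfl⟩, hux.prodMk_nhds huv⟩
  · rintro ⟨p, hp, hlim⟩
    choose u hu hup using hp
    obtain rfl : (fun i => (u i, gradient f (u i))) = p := funext hup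
    rw [nhds_prod_eq, tendsto_prod_iff'] at hlim
    exact ⟨u, hu, hlim.1, hlim.2⟩

theorem isClosed_limitingGradients (x : EuclideanSpace ℝ (Fin d)) :
    IsClosed (limitingGradients f x) := by
  have h : limitingGradients f x = (fun v => (x, v)) ⁻¹'
      closure ((fun u => (u, gradient f u)) '' {u | DifferentiableAt ℝ f u}) :=
    Set.ext fun v => mem_limitingGradients_iff
  rw [h]
  exact isClosed_closure.preimage (by fun_prop)

theorem LocallyLipschitz.eventually_norm_gradient_le (hf : LocallyLipschitz f)
    (x : EuclideanSpace ℝ (Fin d)) :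
    ∃ K : ℝ, ∀ᶠ u in 𝓝 x, ‖gradient f u‖ ≤ K := by
  obtain ⟨K, t, ht, hK⟩ := hf x
  refine ⟨K, ?_⟩
  filter_upwards [eventually_eventually_nhds.2 ht] with u hu
  rw [gradient, LinearIsometryEquiv.norm_map]
  exact norm_fderiv_le_of_lipschitzOn ℝ hu hK

theorem LocallyLipschitz.eventually_norm_le_of_mem_clarkeSubdifferential
    (hf : LocallyLipschitz f) (x : EuclideanSpace ℝ (Fin d)) :
    ∃ K : ℝ, ∀ᶠ w in 𝓝 x, ∀ v ∈ clarkeSubdifferential f w, ‖v‖ ≤ K := by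
  obtain ⟨K, hK⟩ := hf.eventually_norm_gradient_le x
  refine ⟨K, ?_⟩
  filter_upwards [eventually_eventually_nhds.2 hK] with w hw v hv
  have hsub : clarkeSubdifferential f w ⊆ Metric.closedBall 0 K := by
    refine convexHull_min ?_ (convex_closedBall 0 K)
    rintro g ⟨u, -, huw, hug⟩
    rw [mem_closedBall_zero_iff]
    exact le_of_tendsto hug.norm (huw.eventually hw)
  simpa using hsub hv

theorem LocallyLipschitz.exists_norm_le_of_mem_clarkeSubdifferential
    (hf : LocallyLipschitz f) {s : Set (EuclideanSpace ℝ (Fin d))} (hs : IsCompact s) :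
    ∃ K : ℝ, ∀ w ∈ s, ∀ v ∈ clarkeSubdifferential f w, ‖v‖ ≤ K := by
  refine hs.induction_on (p := fun s => ∃ K : ℝ, ∀ w ∈ s, ∀ v ∈ clarkeSubdifferential f w, ‖v‖ ≤ K)
    ⟨0, by simp⟩ (fun s t hst ⟨K, hK⟩ => ⟨K, fun w hw => hK w (hst hw)⟩) ?_ ?_
  · rintro s t ⟨K, hK⟩ ⟨K', hK'⟩
    refine ⟨max K K', ?_⟩
    rintro w (hw | hw) v hv
    · exact (hK w hw v hv).trans (le_max_left _ _)
    · exact (hK' w hw v hv).trans (le_max_right _ _)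
  · intro x _
    obtain ⟨K, hK⟩ := hf.eventually_norm_le_of_mem_clarkeSubdifferential x
    exact ⟨_, mem_nhdsWithin_of_mem_nhds hK, K, fun w hw => hw⟩

theorem LocallyLipschitz.isCompact_clarkeSubdifferential (hf : LocallyLipschitz f)
    (x : EuclideanSpace ℝ (Fin d)) : IsCompact (clarkeSubdifferential f x) := by
  obtain ⟨K, hK⟩ := hf.eventually_norm_le_of_mem_clarkeSubdifferential x
  have hcomp : IsCompact (limitingGradients f x) := by
    refine Metric.isCompact_of_isClosed_isBounded (isClosed_limitingGradients x) ?_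
    refine (Metric.isBounded_closedBall (x := 0) (r := K)).subset fun v hv => ?_
    simpa using hK.self_of_nhds v (subset_convexHull ℝ _ hv)
  exact hcomp.convexHull_of_finiteDimensional

/-- Upper semicontinuity of the Clarke subdifferential. -/
theorem LocallyLipschitz.eventually_clarkeSubdifferential_subset (hf : LocallyLipschitz f)
    (x : EuclideanSpace ℝ (Fin d)) {ε : ℝ} (hε : 0 < ε) :
    ∀ᶠ w in 𝓝 x, clarkeSubdifferential f w ⊆ Metric.cthickening ε (clarkeSubdifferential f x) := by
  have hconv : Convex ℝ (clarkeSubdifferential f x) := convex_convexHull ℝ _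
  have key : ∀ᶠ u in 𝓝 x, DifferentiableAt ℝ f u →
      gradient f u ∈ Metric.thickening ε (clarkeSubdifferential f x) := by
    -- Otherwise gradients at points tending to `x` stay outside the thickening; being bounded, they
    -- subconverge, and the limit is a limiting gradient at `x`.
    by_contra hcon
    obtain ⟨u, hux, hu⟩ := exists_seq_forall_of_frequently (not_eventually.1 hcon)
    simp only [Classical.not_imp] at hu
    obtain ⟨K, hK⟩ := hf.eventually_norm_gradient_le x
    have hfreq : ∃ᶠ n in atTop, gradient f (u n) ∈ Metric.closedBall 0 K :=
      Eventually.frequently ((hux.eventually hK).mono fun n hn => by simpa using hn)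
    obtain ⟨v, -, φ, hφ, hv⟩ :=
      tendsto_subseq_of_frequently_bounded Metric.isBounded_closedBall hfreq
    have hvG : v ∈ clarkeSubdifferential f x :=
      subset_convexHull ℝ _ ⟨u ∘ φ, fun i => (hu _).1, hux.comp hφ.tendsto_atTop, hv⟩
    have hnear := hv.eventually
      (Metric.isOpen_thickening.mem_nhds (Metric.self_subset_thickening hε _ hvG))
    obtain ⟨n, hn⟩ := hnear.exists
    exact (hu (φ n)).2 hn
  filter_upwards [eventually_eventually_nhds.2 key] with w hw
  refine convexHull_min ?_ (hconv.cthickening ε)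
  rintro g ⟨u, hu, huw, hug⟩
  refine Metric.isClosed_cthickening.mem_of_tendsto hug ?_
  filter_upwards [huw.eventually hw] with i hi
  exact Metric.thickening_subset_cthickening _ _ (hi (hu i))

end Clarke

/-! ### Limits of shifted curves are subgradient trajectories -/

section Limits

variable {d : ℕ} {f : EuclideanSpace ℝ (Fin d) → ℝ}

/-- Each coordinate is absolutely continuous, hence the integral of its a.e. derivative. -/
theorem LipschitzWith.isArc {z : ℝ → EuclideanSpace ℝ (Fin d)} {L : NNReal}
    (hz : LipschitzWith L z) : IsArc z := by
  have hac (i : Fin d) (a b : ℝ) : AbsolutelyContinuousOnInterval (fun t => z t i) a b := by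
    refine LipschitzOnWith.absolutelyContinuousOnInterval (K := L) ?_
    refine (LipschitzWith.of_dist_le_mul fun s t => ?_).lipschitzOnWith
    refine le_trans ?_ (hz.dist_le_mul s t)
    rw [dist_eq_norm, dist_eq_norm]
    exact PiLp.norm_apply_le (z s - z t) i
  refine ⟨fun t => WithLp.toLp 2 fun i => deriv (fun t => z t i) t, fun T _ => ?_, fun t ht => ?_⟩
  · refine ⟨?_, ?_⟩
    · exact Integrable.of_eval_piLp fun i => ((hac i 0 T).intervalIntegrable_deriv).1
    · exact Integrable.of_eval_piLp fun i => ((hac i 0 T).intervalIntegrable_deriv).2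
  · ext i
    have hint : (∫ τ in (0 : ℝ)..t, WithLp.toLp 2 fun i => deriv (fun t => z t i) τ).ofLp i =
        ∫ τ in (0 : ℝ)..t, deriv (fun t => z t i) τ := by
      rw [intervalIntegral.integral_of_le ht, intervalIntegral.integral_of_le ht]
      exact eval_integral_piLp (f := fun τ => WithLp.toLp 2 fun i => deriv (fun t => z t i) τ)
        (fun i => ((hac i 0 t).intervalIntegrable_deriv).1) i
    rw [PiLp.add_apply, hint, (hac i 0 t).integral_deriv_eq_sub]
    ring

theorem Convex.inv_smul_intervalIntegral_mem {E : Type*} [NormedAddCommGroup E] [NormedSpace ℝ E]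
    [CompleteSpace E] {s : Set E} (hs : Convex ℝ s) (hsc : IsClosed s) {g : ℝ → E} {a h : ℝ}
    (hh : 0 < h) (hg : IntervalIntegrable g volume a (a + h))
    (hmem : ∀ t ∈ Ioc a (a + h), g t ∈ s) : h⁻¹ • ∫ t in a..a + h, g t ∈ s := by
  have hle : a ≤ a + h := by linarith
  have havg := hs.set_average_mem (μ := volume) (t := Ioc a (a + h)) hsc (by simp [hh]) (by simp)
    (ae_restrict_of_forall_mem measurableSet_Ioc hmem) hg.1
  rw [setAverage_eq, ← intervalIntegral.integral_of_le hle] at havg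
  simpa [hh.le] using havg

theorem lipschitzWith_of_eq_sub_integral {V Y : ℝ → EuclideanSpace ℝ (Fin d)} {L : NNReal}
    (hYi : ∀ a b, IntervalIntegrable Y volume a b) (hYb : ∀ t, ‖Y t‖ ≤ L)
    (hV : ∀ t, V t = V 0 - ∫ s in (0 : ℝ)..t, Y s) : LipschitzWith L V := by
  refine LipschitzWith.of_dist_le_mul fun s t => ?_
  rw [dist_comm, dist_comm s t, dist_eq_norm, Real.dist_eq, hV s, hV t, sub_sub_sub_cancel_left,
    intervalIntegral.integral_interval_sub_left (hYi _ _) (hYi _ _), ← abs_neg, neg_sub]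
  exact intervalIntegral.norm_integral_le_of_norm_le_const fun τ _ => hYb τ

/-- Let `V` be a bounded curve with velocity `-Y`, where `Y` is bounded and selects Clarke
subgradients along a curve `X` asymptotic to `V`. Then the shifts `V (τ i + ·)` with `τ i → ∞`
converge pointwise along every ultrafilter to a subgradient trajectory. -/
theorem LocallyLipschitz.exists_subgradientTrajectory_tendsto (hf : LocallyLipschitz f)
    {V X Y : ℝ → EuclideanSpace ℝ (Fin d)} {L : NNReal} {C : ℝ}
    (hYi : ∀ a b, IntervalIntegrable Y volume a b) (hYb : ∀ t, ‖Y t‖ ≤ L)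
    (hV : ∀ t, V t = V 0 - ∫ s in (0 : ℝ)..t, Y s) (hVb : ∀ t, 0 ≤ t → ‖V t‖ ≤ C)
    (hYX : ∀ t, 0 ≤ t → Y t ∈ clarkeSubdifferential f (X t))
    (hXV : Tendsto (fun t => X t - V t) atTop (𝓝 0))
    {ι : Type*} (l : Ultrafilter ι) {τ : ι → ℝ} (hτ0 : ∀ i, 0 ≤ τ i) (hτ : Tendsto τ l atTop) :
    ∃ z : ℝ → EuclideanSpace ℝ (Fin d), Continuous z ∧ IsSubgradientTrajectory f z ∧
      ∀ t, 0 ≤ t → Tendsto (fun i => V (τ i + t)) l (𝓝 (z t)) := by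
  have hVL : LipschitzWith L V := lipschitzWith_of_eq_sub_integral hYi hYb hV
  -- An ultrafilter in a compact ball converges, so all times are handled at once without extracting
  -- subsequences. Freezing time at `max t 0` makes `z` Lipschitz on all of `ℝ`.
  have hlim (t : ℝ) : ∃ a, Tendsto (fun i => V (τ i + max t 0)) l (𝓝 a) := by
    obtain ⟨a, -, ha⟩ := (isCompact_closedBall (0 : EuclideanSpace ℝ (Fin d)) C).ultrafilter_le_nhds
      (l.map fun i => V (τ i + max t 0)) (by
        rw [Ultrafilter.coe_map, le_principal_iff, mem_map]
        refine Filter.univ_mem' fun i => ?_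
        have := hVb (τ i + max t 0) (add_nonneg (hτ0 i) (le_max_right _ _))
        simpa using this)
    exact ⟨a, ha⟩
  choose z hz' using hlim
  have hz (t : ℝ) (ht : 0 ≤ t) : Tendsto (fun i => V (τ i + t)) l (𝓝 (z t)) := by
    simpa [ht] using hz' t
  have hzL : LipschitzWith L z := by
    refine LipschitzWith.of_dist_le_mul fun s t => ?_
    refine le_of_tendsto ((hz' s).dist (hz' t)) (Eventually.of_forall fun i => ?_)
    refine (hVL.dist_le_mul _ _).trans (mul_le_mul_of_nonneg_left ?_ L.coe_nonneg)
    rw [dist_add_left, Real.dist_eq, Real.dist_eq]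
    exact abs_max_sub_max_le_abs s t 0
  refine ⟨z, hzL.continuous, ⟨hzL.isArc, ?_⟩, hz⟩
  filter_upwards [hzL.ae_differentiableAt_real] with t hdiff ht
  refine ⟨hdiff, ?_⟩
  have hK := hf.isCompact_clarkeSubdifferential (z t)
  suffices h : ∀ ε > 0, -deriv z t ∈ Metric.cthickening ε (clarkeSubdifferential f (z t)) by
    rw [← hK.isClosed.closure_eq, Metric.closure_eq_iInter_cthickening]
    exact mem_iInter₂.2 h
  intro ε hε
  have hconv : Convex ℝ (Metric.cthickening ε (clarkeSubdifferential f (z t))) :=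
    (convex_convexHull ℝ _).cthickening ε
  obtain ⟨r, hr, hsub⟩ :=
    Metric.eventually_nhds_iff.1 (hf.eventually_clarkeSubdifferential_subset (z t) hε)
  have hslope := hdiff.hasDerivAt.tendsto_slope_zero_right.neg
  refine Metric.isClosed_cthickening.mem_of_tendsto hslope ?_
  -- The distance from `X s` to `z t` is split into three parts below `r / 3`: the gap `X - V`, the
  -- drift of `V` over a time at most `h`, and the gap between `V (τ i + t)` and `z t`.
  have hsmall : ∀ᶠ h : ℝ in 𝓝[>] 0, L * h < r / 3 := by
    have h0 : Tendsto (fun h : ℝ => L * h) (𝓝[>] 0) (𝓝 (L * 0)) :=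
      (tendsto_nhdsWithin_of_tendsto_nhds tendsto_id).const_mul _
    exact h0.eventually (gt_mem_nhds (by rw [mul_zero]; positivity))
  filter_upwards [hsmall, self_mem_nhdsWithin] with h hLh (hh : 0 < h)
  -- With `h` fixed, the difference quotient of `z` is a limit of quotients of `V`, which up to sign
  -- are means of `Y` over intervals of length `h`. A closed convex set containing the values of `Y`
  -- contains these means.
  have hdiffq : Tendsto (fun i => -(h⁻¹ • (V (τ i + (t + h)) - V (τ i + t)))) l
      (𝓝 (-(h⁻¹ • (z (t + h) - z t)))) :=
    (((hz (t + h) (by positivity)).sub (hz t ht)).const_smul _).neg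
  refine Metric.isClosed_cthickening.mem_of_tendsto hdiffq ?_
  obtain ⟨T, hT⟩ := eventually_atTop.1
    (hXV.eventually (Metric.ball_mem_nhds 0 (by positivity : 0 < r / 3)))
  filter_upwards [hτ.eventually_ge_atTop T,
    (hz t ht).eventually (Metric.ball_mem_nhds _ (by positivity : 0 < r / 3))] with i hiT hi
  have heq : V (τ i + (t + h)) - V (τ i + t) = -∫ s in τ i + t..τ i + t + h, Y s := by
    rw [hV (τ i + (t + h)), hV (τ i + t), sub_sub_sub_cancel_left, ← add_assoc,
      ← neg_sub, intervalIntegral.integral_interval_sub_left (hYi _ _) (hYi _ _)]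
  rw [heq, smul_neg, neg_neg]
  refine hconv.inv_smul_intervalIntegral_mem Metric.isClosed_cthickening hh (hYi _ _) fun s hs => ?_
  have hs0 : 0 ≤ s := (add_nonneg (hτ0 i) ht).trans hs.1.le
  refine hsub ?_ (hYX s hs0)
  have h1 : dist (X s) (V s) < r / 3 := by
    have := hT s (by linarith [hs.1])
    rwa [dist_zero_right, ← dist_eq_norm] at this
  have h2 : dist (V s) (V (τ i + t)) < r / 3 := by
    refine ((hVL.dist_le_mul _ _).trans (mul_le_mul_of_nonneg_left ?_ L.coe_nonneg)).trans_lt hLh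
    rw [Real.dist_eq, abs_of_pos (by linarith [hs.1])]
    linarith [hs.2]
  have h3 : dist (V (τ i + t)) (z t) < r / 3 := hi
  linarith [dist_triangle4 (X s) (V s) (V (τ i + t)) (z t)]

end Limits

/-! ### Convergence along a single realization -/

section Deterministic

/-- `N s` is the least `n` with `s < t (n + 1)`; minimality yields both the lower bound and
monotonicity in `s`. -/
theorem exists_monotone_index {t : ℕ → ℝ} (ht0 : t 0 = 0)
    (htop : Tendsto t atTop atTop) :
    ∃ N : ℝ → ℕ, Monotone N ∧ (∀ s, s < t (N s + 1)) ∧ ∀ s, 0 ≤ s → t (N s) ≤ s := by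
  classical
  have hex (s : ℝ) : ∃ n, s < t (n + 1) :=
    (((tendsto_add_atTop_iff_nat 1).2 htop).eventually_gt_atTop s).exists
  refine ⟨fun s => Nat.find (hex s), fun s s' hs => ?_, fun s => Nat.find_spec (hex s),
    fun s hs => ?_⟩
  · exact Nat.find_min' _ (hs.trans_lt (Nat.find_spec (hex s')))
  · change t (Nat.find (hex s)) ≤ s
    rcases h : Nat.find (hex s) with _ | n
    · rwa [ht0]
    · exact not_lt.1 (Nat.find_min (hex s) (h ▸ n.lt_succ_self))

/-- `i` is the last index up to `e` with `u i ≤ a`, so everything after it up to `e` stays above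
`a`. -/
theorem exists_upcrossing {u : ℕ → ℝ} {a b : ℝ} (hab : a < b) (ha : ∃ᶠ n in atTop, u n < a)
    (hb : ∃ᶠ n in atTop, b < u n) (n : ℕ) :
    ∃ i e, n ≤ i ∧ i < e ∧ u i ≤ a ∧ b < u e ∧ ∀ m, i < m → m ≤ e → a < u m := by
  classical
  obtain ⟨m, hnm, hm⟩ := frequently_atTop.1 ha n
  obtain ⟨e, hme, he⟩ := frequently_atTop.1 hb m
  have hspec := Nat.findGreatest_spec (P := fun j => u j ≤ a) hme hm.le
  have hle : Nat.findGreatest (fun j => u j ≤ a) e ≤ e := Nat.findGreatest_le e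
  refine ⟨Nat.findGreatest (fun j => u j ≤ a) e, e, hnm.trans (Nat.le_findGreatest hme hm.le),
    hle.lt_of_ne fun h => ?_, hspec, he, fun j hj hje => not_le.1 (Nat.findGreatest_is_greatest hj hje)⟩
  rw [h] at hspec
  linarith

variable {d : ℕ} {f : EuclideanSpace ℝ (Fin d) → ℝ} {α : ℕ → ℝ}
  {x y ξ : ℕ → EuclideanSpace ℝ (Fin d)} {S : EuclideanSpace ℝ (Fin d)} {C : ℝ}

/-- A continuous-time interpolation `V` of the subgradient method whose shifts converge, along
ultrafilters, to subgradient trajectories. -/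
theorem LocallyLipschitz.exists_interpolation (hf : LocallyLipschitz f)
    (hsub : ∀ k, y k ∈ clarkeSubdifferential f (x k))
    (hstep : ∀ k, x (k + 1) = x k - α k • (y k + ξ k)) (hα : ∀ k, 0 ≤ α k)
    (hα_sum : Tendsto (fun n => ∑ k ∈ Finset.range n, α k) atTop atTop)
    (hα_zero : Tendsto α atTop (𝓝 0)) (hC : ∀ k, ‖x k‖ ≤ C)
    (hS : Tendsto (fun n => ∑ k ∈ Finset.range n, α k • ξ k) atTop (𝓝 S)) :
    ∃ (V : ℝ → EuclideanSpace ℝ (Fin d)) (N : ℝ → ℕ) (L : NNReal), LipschitzWith L V ∧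
      Tendsto (fun k => x (k + 1) - x k) atTop (𝓝 0) ∧
      Tendsto (fun n => x n - V (∑ k ∈ Finset.range n, α k)) atTop (𝓝 0) ∧
      Tendsto (fun s => x (N s) - V s) atTop (𝓝 0) ∧
      (∀ s, s < ∑ k ∈ Finset.range (N s + 1), α k) ∧
      (∀ s, 0 ≤ s → ∑ k ∈ Finset.range (N s), α k ≤ s) ∧
      ∀ (l : Ultrafilter ℕ) (n : ℕ → ℕ), Tendsto n l atTop →
        ∃ z : ℝ → EuclideanSpace ℝ (Fin d), Continuous z ∧ IsSubgradientTrajectory f z ∧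
          ∀ s, 0 ≤ s →
            Tendsto (fun i => V ((∑ k ∈ Finset.range (n i), α k) + s)) l (𝓝 (z s)) := by
  set t : ℕ → ℝ := fun n => ∑ k ∈ Finset.range n, α k
  have htsucc (k) : t (k + 1) = t k + α k := Finset.sum_range_succ _ _
  have htmono : Monotone t := monotone_nat_of_le_succ fun k => by
    rw [htsucc]; linarith [hα k]
  have ht0 : t 0 = 0 := by simp [t]
  have htnn (k) : 0 ≤ t k := ht0 ▸ htmono k.zero_le
  obtain ⟨N, hNmono, hNlt, hNle⟩ := exists_monotone_index ht0 hα_sum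
  obtain ⟨L, hL⟩ : ∃ L : NNReal, ∀ k, ‖y k‖ ≤ L := by
    obtain ⟨K, hK⟩ := hf.exists_norm_le_of_mem_clarkeSubdifferential
      (isCompact_closedBall (0 : EuclideanSpace ℝ (Fin d)) C)
    exact ⟨K.toNNReal, fun k =>
      (hK _ (by simpa using hC k) _ (hsub k)).trans (Real.le_coe_toNNReal K)⟩
  let Y : ℝ → EuclideanSpace ℝ (Fin d) := fun s => y (N s)
  have hYb (s) : ‖Y s‖ ≤ L := hL _
  have hYm : Measurable Y := (measurable_of_countable y).comp hNmono.measurable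
  have hYi (a b : ℝ) : IntervalIntegrable Y volume a b := by
    refine (intervalIntegrable_const (c := (L : ℝ))).mono_fun hYm.aestronglyMeasurable ?_
    exact Eventually.of_forall fun s => by simpa using hYb s
  -- The initial value `x 0 - S` makes `x n - V (t n)` equal to `S` minus the `n`-th partial sum of
  -- the noise series, which tends to `0`.
  let V : ℝ → EuclideanSpace ℝ (Fin d) := fun s => x 0 - S - ∫ r in (0 : ℝ)..s, Y r
  have hV (s) : V s = V 0 - ∫ r in (0 : ℝ)..s, Y r := by simp [V]
  have hVL : LipschitzWith L V := lipschitzWith_of_eq_sub_integral hYi hYb hV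
  have hint (k) : ∫ r in t k..t (k + 1), Y r = α k • y k := by
    have hcongr : ∫ r in t k..t (k + 1), Y r = ∫ _ in t k..t (k + 1), y k := by
      refine intervalIntegral.integral_congr_ae ?_
      -- At the right endpoint the index has already moved past `k`; that single point is null.
      have hne : ∀ᵐ r : ℝ, r ≠ t (k + 1) := by simp [ae_iff]
      filter_upwards [hne] with r hr hmem
      rw [uIoc_of_le (htmono k.le_succ)] at hmem
      have h1 : N r < k + 1 := htmono.reflect_lt
        ((hNle r ((htnn k).trans hmem.1.le)).trans_lt (hmem.2.lt_of_ne hr))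
      have h2 : k < N r + 1 := htmono.reflect_lt (hmem.1.trans (hNlt r))
      have h3 : N r = k := by omega
      simp only [Y, h3]
    rw [hcongr, intervalIntegral.integral_const, htsucc, add_sub_cancel_left]
  have hVt (n) : V (t n) = x n + ∑ k ∈ Finset.range n, α k • ξ k - S := by
    induction n with
    | zero => simp [V, ht0]
    | succ n ih =>
      have h1 : V (t (n + 1)) = V (t n) - α n • y n := by
        rw [hV (t (n + 1)), hV (t n), ← hint n,
          ← intervalIntegral.integral_add_adjacent_intervals (hYi 0 (t n)) (hYi _ _)]
        abel
      rw [h1, ih, hstep, Finset.sum_range_succ, smul_add]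
      abel
  have hxV : Tendsto (fun n => x n - V (t n)) atTop (𝓝 0) := by
    have h : Tendsto (fun n => S - ∑ k ∈ Finset.range n, α k • ξ k) atTop (𝓝 (S - S)) :=
      tendsto_const_nhds.sub hS
    rw [sub_self] at h
    refine h.congr fun n => ?_
    rw [hVt]; abel
  -- During step `n` the curve `V` moves by at most `L * α n`, so `b n` bounds the gap to `x n`
  -- throughout the step.
  let b : ℕ → ℝ := fun n => ‖x n - V (t n)‖ + L * α n
  have hb : Tendsto b atTop (𝓝 0) := by
    simpa using hxV.norm.add (hα_zero.const_mul (L : ℝ))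
  have hbV (s) (hs : 0 ≤ s) : ‖x (N s) - V s‖ ≤ b (N s) := by
    have h1 : ‖V (t (N s)) - V s‖ ≤ L * α (N s) := by
      rw [← dist_eq_norm]
      refine (hVL.dist_le_mul _ _).trans (mul_le_mul_of_nonneg_left ?_ L.coe_nonneg)
      rw [dist_comm, Real.dist_eq, abs_of_nonneg (by linarith [hNle s hs])]
      linarith [hNlt s, htsucc (N s)]
    calc ‖x (N s) - V s‖ = ‖(x (N s) - V (t (N s))) + (V (t (N s)) - V s)‖ := by
          rw [sub_add_sub_cancel]
      _ ≤ b (N s) := (norm_add_le _ _).trans (add_le_add le_rfl h1)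
  have hNtop : Tendsto N atTop atTop := by
    refine tendsto_atTop.2 fun k => ?_
    filter_upwards [eventually_ge_atTop (t k)] with s hs
    exact Nat.lt_succ_iff.1 (htmono.reflect_lt (hs.trans_lt (hNlt s)))
  have hXV : Tendsto (fun s => x (N s) - V s) atTop (𝓝 0) := by
    refine squeeze_zero_norm' ?_ (hb.comp hNtop)
    filter_upwards [eventually_ge_atTop 0] with s hs using hbV s hs
  obtain ⟨B, hB⟩ := hb.bddAbove_range
  have hVb (s) (hs : 0 ≤ s) : ‖V s‖ ≤ C + B := by
    calc ‖V s‖ = ‖x (N s) - (x (N s) - V s)‖ := by rw [sub_sub_cancel]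
      _ ≤ C + B := (norm_sub_le _ _).trans
          (add_le_add (hC _) ((hbV s hs).trans (hB (mem_range_self _))))
  have hdiff : Tendsto (fun k => x (k + 1) - x k) atTop (𝓝 0) := by
    have h1 : Tendsto (fun k => V (t (k + 1)) - V (t k)) atTop (𝓝 0) := by
      refine squeeze_zero_norm (a := fun k => L * α k) (fun k => ?_)
        (by simpa using hα_zero.const_mul (L : ℝ))
      rw [← dist_eq_norm]
      refine (hVL.dist_le_mul _ _).trans (mul_le_mul_of_nonneg_left ?_ L.coe_nonneg)
      rw [Real.dist_eq, htsucc, add_sub_cancel_left, abs_of_nonneg (hα k)]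
    have h2 := (((tendsto_add_atTop_iff_nat 1).2 hxV).sub hxV).add h1
    rw [sub_zero, add_zero] at h2
    refine h2.congr fun k => ?_
    abel
  refine ⟨V, N, L, hVL, hdiff, hxV, hXV, hNlt, hNle, fun l n hn => ?_⟩
  exact hf.exists_subgradientTrajectory_tendsto hYi hYb hV hVb (fun s _ => hsub _) hXV l
    (fun i => htnn (n i)) (hα_sum.comp hn)

/-- Convergence of the subgradient method along a realization whose weighted noise series
converges. -/
theorem LocallyLipschitz.critical_of_mapClusterPt_and_tendsto (hf : LocallyLipschitz f)
    (hsard : WeakSard f) (hdesc : DescentCondition f)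
    (hsub : ∀ k, y k ∈ clarkeSubdifferential f (x k))
    (hstep : ∀ k, x (k + 1) = x k - α k • (y k + ξ k)) (hα : ∀ k, 0 ≤ α k)
    (hα_sum : Tendsto (fun n => ∑ k ∈ Finset.range n, α k) atTop atTop)
    (hα_zero : Tendsto α atTop (𝓝 0)) (hC : ∀ k, ‖x k‖ ≤ C)
    (hS : Tendsto (fun n => ∑ k ∈ Finset.range n, α k • ξ k) atTop (𝓝 S)) :
    (∀ a, MapClusterPt a atTop x → IsClarkeCritical f a) ∧
      ∃ c : ℝ, Tendsto (fun k => f (x k)) atTop (𝓝 c) := by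
  obtain ⟨V, N, L, hVL, hdiff, hxV, hXV, hNlt, hNle, htraj⟩ :=
    hf.exists_interpolation hsub hstep hα hα_sum hα_zero hC hS
  set t : ℕ → ℝ := fun n => ∑ k ∈ Finset.range n, α k
  have htmono : Monotone t := monotone_nat_of_le_succ fun k => by
    simp only [t, Finset.sum_range_succ]; linarith [hα k]
  have hfc : Continuous f := hf.continuous
  have hXlim {l : Ultrafilter ℕ} {n : ℕ → ℕ} {s : ℝ} {a : EuclideanSpace ℝ (Fin d)}
      (hn : Tendsto n l atTop) (h : Tendsto (fun i => V (t (n i) + s)) l (𝓝 a)) :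
      Tendsto (fun i => x (N (t (n i) + s))) l (𝓝 a) := by
    have h1 := (hXV.comp (tendsto_atTop_add_const_right _ s (hα_sum.comp hn))).add h
    rw [zero_add] at h1
    exact h1.congr fun i => sub_add_cancel _ _
  have hxlim {l : Ultrafilter ℕ} {n : ℕ → ℕ} {a : EuclideanSpace ℝ (Fin d)}
      (hn : Tendsto n l atTop) (h : Tendsto (fun i => V (t (n i))) l (𝓝 a)) :
      Tendsto (fun i => x (n i)) l (𝓝 a) := by
    have h1 := (hxV.comp hn).add h
    rw [zero_add] at h1
    exact h1.congr fun i => sub_add_cancel _ _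
  have hconv : ∃ c : ℝ, Tendsto (fun k => f (x k)) atTop (𝓝 c) := by
    have hbdd := ((isCompact_closedBall (0 : EuclideanSpace ℝ (Fin d)) C).image hfc).isBounded
    have hmem (k) : f (x k) ∈ f '' Metric.closedBall 0 C := ⟨x k, by simpa using hC k, rfl⟩
    obtain ⟨lo, hlo⟩ := hbdd.bddBelow
    obtain ⟨hi, hhi⟩ := hbdd.bddAbove
    refine tendsto_of_no_upcrossings hsard ?_
      (isBoundedUnder_of ⟨hi, fun k => hhi (hmem k)⟩) (isBoundedUnder_of ⟨lo, fun k => hlo (hmem k)⟩)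
    rintro a ha b - hab ⟨hfa, hfb⟩
    choose i e hni hie hia heb hmid using exists_upcrossing hab hfa hfb
    let l : Ultrafilter ℕ := hyperfilter ℕ
    have hl : (l : Filter ℕ) ≤ atTop := Nat.hyperfilter_le_atTop
    have hitop : Tendsto i l atTop := (tendsto_atTop_mono hni tendsto_id).mono_left hl
    have hetop : Tendsto e l atTop := tendsto_atTop_mono (fun j => (hie j).le) hitop
    have hktop : Tendsto (fun j => i j + 1) l atTop :=
      tendsto_atTop_mono (fun j => (i j).le_succ) hitop
    -- Since steps tend to `0`, the last iterate with value at most `a` and the next one, with value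
    -- above `a`, share the limit `z 0`, which therefore lies exactly on level `a`.
    obtain ⟨z, hzc, hztraj, hz⟩ := htraj l (fun j => i j + 1) hktop
    have hk0 : Tendsto (fun j => x (i j + 1)) l (𝓝 (z 0)) :=
      hxlim hktop (by simpa using hz 0 le_rfl)
    have hi0 : Tendsto (fun j => x (i j)) l (𝓝 (z 0)) := by
      have h := hk0.sub (hdiff.comp hitop)
      rw [sub_zero] at h
      exact h.congr fun j => sub_sub_cancel _ _
    have hfz0 : f (z 0) = a := by
      apply le_antisymm
      · exact le_of_tendsto ((hfc.tendsto _).comp hi0) (Eventually.of_forall hia)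
      · exact ge_of_tendsto ((hfc.tendsto _).comp hk0)
          (Eventually.of_forall fun j => (hmid j _ (i j).lt_succ_self (hie j)).le)
    obtain ⟨T, hT, hlt, hle⟩ := hdesc z hztraj fun hcrit => ha ⟨z 0, hcrit, hfz0⟩
    have hsup (s) (hs : s ∈ Icc 0 T) : f (z s) ≤ a := by
      refine (le_csSup ?_ (mem_image_of_mem _ hs)).trans (hle.trans_eq hfz0)
      exact (isCompact_Icc.image (hfc.comp hzc)).bddAbove
    -- Otherwise the elapsed times `t (e j) - t (i j + 1)` converge to some `s` in `[0, T]` and `x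
    -- (e j)` tends to `z s`, giving `f (z s) ≥ b > a`.
    have hexit : ∀ᶠ j in (l : Filter ℕ), t (i j + 1) + T < t (e j) := by
      by_contra hcon
      rw [← Ultrafilter.eventually_not] at hcon
      obtain ⟨s, hs, hlim⟩ := (isCompact_Icc (a := (0 : ℝ)) (b := T)).ultrafilter_le_nhds
        (l.map fun j => t (e j) - t (i j + 1)) (by
          rw [Ultrafilter.coe_map, le_principal_iff, mem_map]
          filter_upwards [hcon] with j hj
          exact ⟨sub_nonneg.2 (htmono (hie j)), by linarith [not_lt.1 hj]⟩)
      replace hlim : Tendsto (fun j => t (e j) - t (i j + 1)) l (𝓝 s) := hlim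
      have hVe : Tendsto (fun j => V (t (e j))) l (𝓝 (z s)) := by
        refine (hz s hs.1).congr_dist ?_
        refine squeeze_zero (fun _ => dist_nonneg) (fun j => hVL.dist_le_mul _ _)
          (g := fun j => L * dist (t (i j + 1) + s) (t (e j))) ?_
        have h1 : Tendsto (fun j => L * dist s (t (e j) - t (i j + 1))) l (𝓝 (L * dist s s)) :=
          (tendsto_const_nhds.dist hlim).const_mul _
        rw [dist_self, mul_zero] at h1
        refine h1.congr fun j => ?_
        rw [Real.dist_eq, Real.dist_eq]
        congr 2
        ring
      have hbz : b ≤ f (z s) := ge_of_tendsto ((hfc.tendsto _).comp (hxlim hetop hVe))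
        (Eventually.of_forall fun j => (heb j).le)
      linarith [hsup s hs]
    -- By `hexit`, the iterate at time `T` after the crossing has index strictly between `i j` and
    -- `e j`, where the values exceed `a`.
    have haz : a ≤ f (z T) := by
      refine ge_of_tendsto ((hfc.tendsto _).comp (hXlim hktop (hz T hT.le))) ?_
      filter_upwards [hexit] with j hj
      have htk : 0 ≤ t (i j + 1) := Finset.sum_nonneg fun k _ => hα k
      have h1 : i j + 1 < N (t (i j + 1) + T) + 1 := htmono.reflect_lt
        ((by linarith : t (i j + 1) < t (i j + 1) + T).trans (hNlt _))
      have h2 : N (t (i j + 1) + T) < e j :=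
        htmono.reflect_lt ((hNle _ (by positivity)).trans_lt hj)
      exact (hmid j _ (by omega) h2.le).le
    linarith
  refine ⟨fun a ha => ?_, hconv⟩
  obtain ⟨c, hc⟩ := hconv
  by_contra hcrit
  obtain ⟨l, hl, hla⟩ := mapClusterPt_iff_ultrafilter.1 ha
  -- The trajectory issuing from `a` has `f (z T) = c = f (z 0)`, which contradicts descent.
  obtain ⟨z, hzc, hztraj, hz⟩ := htraj l id hl
  have hn : Tendsto (id : ℕ → ℕ) l atTop := hl
  have hz0 : z 0 = a := by
    have h0 : Tendsto (fun n => V (t (id n))) l (𝓝 (z 0)) := by simpa using hz 0 le_rfl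
    exact tendsto_nhds_unique (hxlim hn h0) hla
  obtain ⟨T, hT, hlt, hle⟩ := hdesc z hztraj (by rwa [hz0])
  have hf0 : f a = c := tendsto_nhds_unique ((hfc.tendsto _).comp hla) (hc.mono_left hl)
  have hNtop : Tendsto (fun n => N (t n + T)) l atTop := by
    refine tendsto_atTop_mono (fun n => ?_) hn
    exact Nat.lt_succ_iff.1 (htmono.reflect_lt
      ((by linarith : t n < t n + T).trans (hNlt _)))
  have hfT : f (z T) = c :=
    tendsto_nhds_unique ((hfc.tendsto _).comp (hXlim hn (hz T hT.le))) (hc.comp hNtop)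
  rw [hz0] at hle
  linarith

end Deterministic

/-! ### The filtration of past information -/

section PastSigmaField

variable {Ω : Type*} {d : ℕ} {x y ξ : ℕ → Ω → EuclideanSpace ℝ (Fin d)}

theorem pastSigmaField_mono : Monotone (pastSigmaField x y ξ) := by
  intro k l hkl
  refine sup_le_sup ?_ ?_
  · exact iSup_mono fun j => iSup_mono' fun hj => ⟨hj.trans hkl, le_rfl⟩
  · exact iSup_mono fun j => iSup_mono' fun hj => ⟨hj.trans_le hkl, le_rfl⟩

theorem measurable_pastSigmaField_iterate (k : ℕ) : Measurable[pastSigmaField x y ξ k] (x k) := by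
  refine measurable_iff_comap_le.2 (le_sup_of_le_left ?_)
  exact le_iSup₂_of_le (f := fun j (_ : j ≤ k) => MeasurableSpace.comap (x j) inferInstance ⊔
    MeasurableSpace.comap (y j) inferInstance) k le_rfl le_sup_left

theorem measurable_pastSigmaField_noise {j k : ℕ} (hjk : j < k) :
    Measurable[pastSigmaField x y ξ k] (ξ j) := by
  refine measurable_iff_comap_le.2 (le_sup_of_le_right ?_)
  exact le_iSup₂_of_le (f := fun j (_ : j < k) => MeasurableSpace.comap (ξ j) inferInstance)
    j hjk le_rfl

theorem measurableSet_pastSigmaField_norm_le (k : ℕ) (R : ℝ) :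
    MeasurableSet[pastSigmaField x y ξ k] {ω | ‖x k ω‖ ≤ R} :=
  measurable_pastSigmaField_iterate k (t := {a | ‖a‖ ≤ R})
    (isClosed_le continuous_norm continuous_const).measurableSet

end PastSigmaField

/-! ### Almost sure convergence of the weighted noise series -/

section Noise

variable {Ω : Type*} [mΩ : MeasurableSpace Ω]

/-- A series of square integrable martingale differences with summable variances converges a.s. -/
theorem ae_tendsto_sum_of_martingaleDifference {P : Measure Ω} [IsProbabilityMeasure P]
    {ℱ : Filtration ℕ mΩ} {η : ℕ → Ω → ℝ} (hadp : ∀ k, StronglyMeasurable[ℱ (k + 1)] (η k))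
    (hL2 : ∀ k, MemLp (η k) 2 P) (hcond : ∀ k, P[η k | ℱ k] =ᵐ[P] 0) {B : ℝ}
    (hB : ∀ n, ∑ k ∈ Finset.range n, ∫ ω, η k ω ^ 2 ∂P ≤ B) :
    ∀ᵐ ω ∂P, ∃ l : ℝ, Tendsto (fun n => ∑ k ∈ Finset.range n, η k ω) atTop (𝓝 l) := by
  let M : ℕ → Ω → ℝ := fun n ω => ∑ k ∈ Finset.range n, η k ω
  have hMsucc (n) : M (n + 1) = M n + η n := by
    ext ω; simp [M, Finset.sum_range_succ]
  have hMadp : StronglyAdapted ℱ M := by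
    intro n
    refine Finset.stronglyMeasurable_fun_sum _ fun k hk => ?_
    exact (hadp k).mono (ℱ.mono (Finset.mem_range.1 hk))
  have hML2 (n) : MemLp (M n) 2 P := memLp_finsetSum _ fun k _ => hL2 k
  have hMint (n) : Integrable (M n) P := (hML2 n).integrable one_le_two
  have hmart : Martingale M ℱ P := by
    refine martingale_of_condExp_sub_eq_zero_nat hMadp hMint fun n => ?_
    rw [hMsucc, add_sub_cancel_left]
    exact hcond n
  -- Orthogonality of increments: `M n` is known at time `n`, so it can be pulled out of the
  -- conditional expectation of the product. The second moment of `M n` is then the sum of the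
  -- variances.
  have horth (n) : ∫ ω, M n ω * η n ω ∂P = 0 := by
    have hint : Integrable (M n * η n) P := (hML2 n).integrable_mul (hL2 n)
    have h := condExp_mul_of_stronglyMeasurable_left (hMadp n) hint
      ((hL2 n).integrable one_le_two)
    have h0 : P[M n * η n | ℱ n] =ᵐ[P] 0 := by
      filter_upwards [h, hcond n] with ω h1 h2
      simp [h1, h2]
    calc ∫ ω, M n ω * η n ω ∂P = ∫ ω, (P[M n * η n | ℱ n]) ω ∂P := (integral_condExp (ℱ.le n)).symm
      _ = 0 := by rw [integral_congr_ae h0]; simp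
  have hsq (n) : ∫ ω, M n ω ^ 2 ∂P = ∑ k ∈ Finset.range n, ∫ ω, η k ω ^ 2 ∂P := by
    induction n with
    | zero => simp [M]
    | succ n ih =>
      have h1 : Integrable (fun ω => M n ω ^ 2) P := (hML2 n).integrable_sq
      have h2 : Integrable (fun ω => η n ω ^ 2) P := (hL2 n).integrable_sq
      have h3 : Integrable (fun ω => M n ω * η n ω) P := (hML2 n).integrable_mul (hL2 n)
      calc ∫ ω, M (n + 1) ω ^ 2 ∂P
          = ∫ ω, (M n ω ^ 2 + 2 * (M n ω * η n ω) + η n ω ^ 2) ∂P := by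
            congr 1; ext ω; simp only [hMsucc, Pi.add_apply]; ring
        _ = ∑ k ∈ Finset.range (n + 1), ∫ ω, η k ω ^ 2 ∂P := by
            have h4 : Integrable (fun ω => M n ω ^ 2 + 2 * (M n ω * η n ω)) P :=
              h1.add (h3.const_mul 2)
            rw [integral_add h4 h2, integral_add h1 (h3.const_mul 2),
              integral_const_mul, horth, ih, Finset.sum_range_succ]
            ring
  -- The inequality `|m| ≤ 1 + m ^ 2` turns the variance bound `B` into the L¹ bound `1 + B` needed
  -- for martingale convergence.
  refine hmart.submartingale.exists_ae_tendsto_of_bdd (R := (1 + B).toNNReal) fun n => ?_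
  have h1 : eLpNorm (M n) 1 P = ENNReal.ofReal (∫ ω, ‖M n ω‖ ∂P) := by
    rw [eLpNorm_one_eq_lintegral_enorm, ofReal_integral_norm_eq_lintegral_enorm (hMint n)]
  rw [h1]
  refine ENNReal.ofReal_le_ofReal ?_
  calc ∫ ω, ‖M n ω‖ ∂P ≤ ∫ ω, (1 + M n ω ^ 2) ∂P := by
        refine integral_mono (hMint n).norm ((integrable_const 1).add (hML2 n).integrable_sq)
          fun ω => ?_
        simp only [Real.norm_eq_abs]
        nlinarith [sq_abs (M n ω), sq_nonneg (|M n ω| - 1)]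
    _ = 1 + ∫ ω, M n ω ^ 2 ∂P := by
        rw [integral_add (integrable_const 1) (hML2 n).integrable_sq]; simp
    _ ≤ 1 + B := by rw [hsq]; linarith [hB n]

variable {d : ℕ} {x y ξ : ℕ → Ω → EuclideanSpace ℝ (Fin d)}

theorem pastSigmaField_le (hx : ∀ k, Measurable (x k)) (hy : ∀ k, Measurable (y k))
    (hξ : ∀ k, Measurable (ξ k)) (k : ℕ) : pastSigmaField x y ξ k ≤ mΩ :=
  sup_le (iSup₂_le fun j _ => sup_le (hx j).comap_le (hy j).comap_le)
    (iSup₂_le fun j _ => (hξ j).comap_le)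

/-- The event belongs to the past, so the conditional second moment can be integrated over it, and
there it is bounded. This makes the truncated noise square integrable although `ξ k` itself need not
be. -/
theorem lintegral_indicator_noise_sq_le {P : Measure Ω} [IsProbabilityMeasure P]
    (hx : ∀ k, Measurable (x k)) (hy : ∀ k, Measurable (y k)) (hξ : ∀ k, Measurable (ξ k))
    {p : EuclideanSpace ℝ (Fin d) → ℝ} {k : ℕ} {R M : ℝ} (hM : ∀ a, ‖a‖ ≤ R → p a ≤ M)
    (hp : ∀ᵐ ω ∂P, condLExp (pastSigmaField x y ξ k) P
      (fun ω' => ENNReal.ofReal (‖ξ k ω'‖ ^ 2)) ω ≤ ENNReal.ofReal (p (x k ω))) :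
    ∫⁻ ω in {ω | ‖x k ω‖ ≤ R}, ENNReal.ofReal (‖ξ k ω‖ ^ 2) ∂P ≤ ENNReal.ofReal M := by
  have hm := pastSigmaField_le hx hy hξ k
  have hA : MeasurableSet[pastSigmaField x y ξ k] {ω | ‖x k ω‖ ≤ R} :=
    measurableSet_pastSigmaField_norm_le k R
  rw [← setLIntegral_condLExp hm P _ hA]
  calc ∫⁻ ω in {ω | ‖x k ω‖ ≤ R}, condLExp (pastSigmaField x y ξ k) P
        (fun ω' => ENNReal.ofReal (‖ξ k ω'‖ ^ 2)) ω ∂P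
      ≤ ∫⁻ _ in {ω | ‖x k ω‖ ≤ R}, ENNReal.ofReal M ∂P := by
        refine lintegral_mono_ae ?_
        filter_upwards [ae_restrict_of_ae hp, ae_restrict_mem (hm _ hA)] with ω h1 h2
        exact h1.trans (ENNReal.ofReal_le_ofReal (hM _ h2))
    _ ≤ ENNReal.ofReal M := by
        rw [setLIntegral_const]
        exact mul_le_of_le_one_right' prob_le_one

/-- The weighted noise series converges almost surely on the event that the iterates stay
bounded. -/
theorem IsControlledNoise.ae_tendsto_sum {P : Measure Ω} [IsProbabilityMeasure P]
    (hx : ∀ k, Measurable (x k)) (hy : ∀ k, Measurable (y k)) (hξ : ∀ k, Measurable (ξ k))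
    {α : ℕ → ℝ} (hα : Summable fun k => α k ^ 2) (hbdd : ∀ᵐ ω ∂P, ∃ C : ℝ, ∀ k, ‖x k ω‖ ≤ C)
    (hnoise : IsControlledNoise P x y ξ) :
    ∀ᵐ ω ∂P, ∃ S, Tendsto (fun n => ∑ k ∈ Finset.range n, α k • ξ k ω) atTop (𝓝 S) := by
  obtain ⟨hint, hmean, p, -, hpb, hp⟩ := hnoise
  have hm := pastSigmaField_le hx hy hξ
  let ℱ : Filtration ℕ mΩ := ⟨pastSigmaField x y ξ, pastSigmaField_mono, hm⟩
  -- Each term is cut off by its own past event, which preserves the martingale difference property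
  -- coordinatewise and bounds its variance by a multiple of `α k ^ 2`.
  have htrunc (R : ℕ) (i : Fin d) : ∀ᵐ ω ∂P, ∃ l : ℝ, Tendsto (fun n => ∑ k ∈ Finset.range n,
      {ω | ‖x k ω‖ ≤ R}.indicator (fun ω => α k * ξ k ω i) ω) atTop (𝓝 l) := by
    obtain ⟨M, hM⟩ := hpb _ (Metric.isBounded_closedBall (x := 0) (r := (R : ℝ)))
    have hMp (a) (ha : ‖a‖ ≤ (R : ℝ)) : p a ≤ max M 0 :=
      (hM ⟨a, by simpa using ha, rfl⟩).trans (le_max_left _ _)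
    have hA (k) : MeasurableSet[ℱ k] {ω | ‖x k ω‖ ≤ (R : ℝ)} :=
      measurableSet_pastSigmaField_norm_le k R
    have hcoord (k) : Measurable fun ω => ξ k ω i := by have := hξ k; fun_prop
    have hmom (k) : ∫⁻ ω, ENNReal.ofReal
        (({ω | ‖x k ω‖ ≤ (R : ℝ)}.indicator (fun ω => α k * ξ k ω i) ω) ^ 2) ∂P ≤
        ENNReal.ofReal (α k ^ 2 * max M 0) := by
      have h1 := lintegral_indicator_noise_sq_le (P := P) hx hy hξ hMp
        (hp.mono fun ω h => h k)
      rw [ENNReal.ofReal_mul (sq_nonneg _)]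
      refine le_trans ?_ (mul_le_mul_right h1 _)
      rw [← lintegral_const_mul _ (by have := hξ k; fun_prop),
        ← lintegral_indicator (hm k _ (hA k))]
      refine lintegral_mono fun ω => ?_
      by_cases hω : ω ∈ {ω | ‖x k ω‖ ≤ (R : ℝ)}
      · simp only [indicator_of_mem hω]
        rw [← ENNReal.ofReal_mul (sq_nonneg _), mul_pow]
        have hle : ξ k ω i ^ 2 ≤ ‖ξ k ω‖ ^ 2 :=
          sq_le_sq.2 (by simpa using PiLp.norm_apply_le (ξ k ω) i)
        exact ENNReal.ofReal_le_ofReal (mul_le_mul_of_nonneg_left hle (sq_nonneg _))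
      · simp [indicator_of_notMem hω]
    have hmeas (k) : AEStronglyMeasurable
        ({ω | ‖x k ω‖ ≤ (R : ℝ)}.indicator fun ω => α k * ξ k ω i) P :=
      (((hcoord k).const_mul (α k)).indicator (hm k _ (hA k))).aestronglyMeasurable
    have hL2 (k) : MemLp ({ω | ‖x k ω‖ ≤ (R : ℝ)}.indicator fun ω => α k * ξ k ω i) 2 P := by
      rw [memLp_two_iff_integrable_sq (hmeas k)]
      refine ⟨(hmeas k).pow 2, ?_⟩
      rw [hasFiniteIntegral_iff_ofReal (Eventually.of_forall fun ω => sq_nonneg _)]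
      exact (hmom k).trans_lt ENNReal.ofReal_lt_top
    refine ae_tendsto_sum_of_martingaleDifference (ℱ := ℱ) (B := (∑' k, α k ^ 2) * max M 0)
      (fun k => ?_) hL2 (fun k => ?_) fun n => ?_
    · have h1 : Measurable[ℱ (k + 1)] (ξ k) := measurable_pastSigmaField_noise k.lt_succ_self
      have h2 : Measurable[ℱ (k + 1)] fun ω => α k * ξ k ω i := by fun_prop
      exact (h2.indicator (ℱ.mono k.le_succ _ (hA k))).stronglyMeasurable
    · let T : EuclideanSpace ℝ (Fin d) →L[ℝ] ℝ := α k • EuclideanSpace.proj i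
      have h1 := T.comp_condExp_comm (m := pastSigmaField x y ξ k) (hint k)
      have h2 : Integrable (fun ω => α k * ξ k ω i) P := T.integrable_comp (hint k)
      filter_upwards [condExp_indicator h2 (hA k), h1, hmean] with ω h3 h4 h5
      rw [h3]
      have h6 : P[fun ω => α k * ξ k ω i | ℱ k] ω = 0 := by
        refine h4.symm.trans ?_
        simp [h5 k]
      by_cases hω : ω ∈ {ω | ‖x k ω‖ ≤ (R : ℝ)}
      · rw [indicator_of_mem hω, h6]; rfl
      · rw [indicator_of_notMem hω]; rfl
    · calc ∑ k ∈ Finset.range n, ∫ ω,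
            ({ω | ‖x k ω‖ ≤ (R : ℝ)}.indicator (fun ω => α k * ξ k ω i) ω) ^ 2 ∂P
          ≤ ∑ k ∈ Finset.range n, α k ^ 2 * max M 0 := by
            refine Finset.sum_le_sum fun k _ => ?_
            rw [integral_eq_lintegral_of_nonneg_ae (Eventually.of_forall fun ω => sq_nonneg _)
              ((hmeas k).pow 2)]
            exact ENNReal.toReal_le_of_le_ofReal (by positivity) (hmom k)
        _ ≤ (∑' k, α k ^ 2) * max M 0 := by
            rw [← Finset.sum_mul]
            exact mul_le_mul_of_nonneg_right
              (hα.sum_le_tsum _ fun k _ => sq_nonneg _) (le_max_right _ _)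
  -- Integer radii keep the exceptional sets countable in number; on a path bounded by `C ≤ R` every
  -- indicator is `1` and the truncated series is the original one.
  filter_upwards [hbdd, ae_all_iff.2 fun R => ae_all_iff.2 (htrunc R)] with ω ⟨C, hC⟩ hω
  obtain ⟨R, hR⟩ := exists_nat_ge C
  choose l hl using hω R
  refine ⟨WithLp.toLp 2 l, ?_⟩
  have hpi : Tendsto (fun n => WithLp.ofLp (∑ k ∈ Finset.range n, α k • ξ k ω)) atTop (𝓝 l) := by
    refine tendsto_pi_nhds.2 fun i => ?_
    refine (hl i).congr fun n => ?_
    rw [WithLp.ofLp_sum, Finset.sum_apply]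
    refine Finset.sum_congr rfl fun k _ => ?_
    rw [indicator_of_mem (show ω ∈ {ω | ‖x k ω‖ ≤ (R : ℝ)} from (hC k).trans hR)]
    simp
  exact ((PiLp.continuous_toLp 2 _).tendsto l).comp hpi

end Noise

/-! ### Almost sure convergence of the stochastic subgradient method -/

theorem mainTheorem3 {Ω : Type*} [MeasurableSpace Ω] (P : Measure Ω) [IsProbabilityMeasure P]
    {d : ℕ} (f : EuclideanSpace ℝ (Fin d) → ℝ) (hf : LocallyLipschitz f)
    (α : ℕ → ℝ) (x y ξ : ℕ → Ω → EuclideanSpace ℝ (Fin d))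
    (hx : ∀ k, Measurable (x k)) (hy : ∀ k, Measurable (y k)) (hξ : ∀ k, Measurable (ξ k))
    -- the stochastic subgradient method
    (hsub : ∀ᵐ ω ∂P, ∀ k, y k ω ∈ clarkeSubdifferential f (x k ω))
    (hstep : ∀ᵐ ω ∂P, ∀ k, x (k + 1) ω = x k ω - α k • (y k ω + ξ k ω))
    -- the standing assumptions
    (hα_nonneg : ∀ k, 0 ≤ α k)
    (hα_sum : Tendsto (fun n => ∑ k ∈ Finset.range n, α k) atTop atTop)
    (hα_sq : Summable (fun k => α k ^ 2))
    (hbdd : ∀ᵐ ω ∂P, ∃ C : ℝ, ∀ k, ‖x k ω‖ ≤ C)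
    (hnoise : IsControlledNoise P x y ξ)
    -- the Lyapunov condition
    (hsard : WeakSard f) (hdesc : DescentCondition f) :
    ∀ᵐ ω ∂P,
      (∀ a, MapClusterPt a atTop (fun k => x k ω) → IsClarkeCritical f a) ∧
      ∃ l : ℝ, Tendsto (fun k => f (x k ω)) atTop (𝓝 l) := by
  have hα_zero : Tendsto α atTop (𝓝 0) :=
    by simpa [Real.sqrt_sq_eq_abs, abs_of_nonneg (hα_nonneg _)] using
      hα_sq.tendsto_atTop_zero.sqrt
  filter_upwards [hsub, hstep, hbdd, hnoise.ae_tendsto_sum hx hy hξ hα_sq hbdd] with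
    ω hsubω hstepω ⟨C, hC⟩ ⟨S, hS⟩
  exact hf.critical_of_mapClusterPt_and_tendsto hsard hdesc hsubω hstepω hα_nonneg hα_sum
    hα_zero hC hS
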